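/- Let $(\mathcal X,\mathcal B,\pi)$ be a $\sigma$-finite measure space, $r:\mathcal X\to\mathbb R$ a measurable reward, and $\varepsilon=\{\varepsilon(x)\}_{x\in\mathcal X}$ an arbitrary jointly measurable real-valued random field on a probability space, independent of the sampled point $X$. For $\Delta r\in L^\infty(\mathcal X,\mathcal B,\pi)$ put $$Q(x)=e^{r(x)}\,\mathbb E[e^{\varepsilon(X)}\mid X=x]=\mathbb E[e^{r(x)+\varepsilon(x)}],\qquad Q_{\Delta r}=e^{\Delta r}Q,\qquad Q_*=\operatorname*{ess\,sup}_{\pi}Q .$$ Let $p_0,p_{\rm ref}$ be probability densities with respect to $\pi$, let $\mathbb P_{\rm ref}$ be the measure with $d\mathbb P_{\rm ref}=p_{\rm ref}\,d\pi$, assume that $p_0\,d\pi\ll\mathbb P_{\rm ref}$, and let $w_0=p_0/p_{\rm ref}$. Let $\alpha\in(0,1)$ and assume: 1. (finite entropy) $\int p\,|\log p|\,d\pi<\infty$ for $p\in\{p_0,p_{\rm ref}\}$; 2. (exponential integrability) $\mathbb E_{X\sim p}\,[e^{|r(X)+\varepsilon(X)|}]<\infty$ for every probability density $p$ with respect to $\pi$;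 3. (finite utility) $0<Q_*<\infty$; 4. (nondegeneracy) $\displaystyle \alpha>\Big(\int \frac{Q_*}{Q_*-Q(x)}\,p_{\rm ref}(x)\,d\pi(x)\Big)^{-1}$, where the integrand is $+\infty$ where $Q=Q_*$, and $\infty^{-1}=0$. For probability densities $w$ with respect to $\mathbb P_{\rm ref}$ define the retraining update with an infinite candidate pool under the perturbed reward $r+\Delta r$ by $$\mathfrak L_{\Delta r}w(x)=\alpha+(1-\alpha)\,\frac{Q_{\Delta r}(x)\,w(x)}{\int w\,Q_{\Delta r}\,d\mathbb P_{\rm ref}},$$ and let $d_{\rm TV}(u,v)=\tfrac12\int|u-v|\,d\mathbb P_{\rm ref}$. Then for all $\Delta r$ with $\|\Delta r\|_\infty$ sufficiently small (in particular for $\Delta r=0$) the limit $\mathfrak L^\infty_{\Delta r}w_0=\lim_{n\to\infty}\mathfrak L^n_{\Delta r}w_0$ exists in $d_{\rm TV}$ as a probability density with respect to $\mathbb P_{\rm ref}$, and $$\limsup_{\|\Delta r\|_\infty\to0}\ \sup_{n\in\mathbb N\cup\{\infty\}} d_{\rm TV}\big(\mathfrak L^n_{\Delta r}w_0,\ \mathfrak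 L^n_0w_0\big)=0,$$ where $\limsup_{\|\Delta r\|_\infty\to0}h(\Delta r):=\lim_{\eta\to0^+}\sup_{\|\Delta r\|_\infty\le\eta}h(\Delta r)$. -/

import Mathlib

open MeasureTheory Filter Topology
open scoped ENNReal

/-- `w` is a probability density with respect to `μ`. -/
def IsDensity {X : Type*} [MeasurableSpace X] (μ : Measure X) (w : X → ℝ) : Prop :=
  Measurable w ∧ (∀ x, 0 ≤ w x) ∧ ∫⁻ x, ENNReal.ofReal (w x) ∂μ = 1

/-- The measure with density `p` with respect to `π`. -/
noncomputable def densityMeasure {X : Type*} [MeasurableSpace X] (π : Measure X) (p : X → ℝ) :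
    Measure X :=
  π.withDensity fun x => ENNReal.ofReal (p x)

/-- Finite Shannon entropy of the density `p`: `∫ p |log p| dπ < ∞`. -/
def FiniteEntropy {X : Type*} [MeasurableSpace X] (π : Measure X) (p : X → ℝ) : Prop :=
  Integrable (fun x => p x * Real.log (p x)) π

/-- Exponential integrability: `E[exp |r(X) + ε(X)|] < ∞` whenever `X`, independent of the random
field `ε`, has a law that is absolutely continuous with respect to `π`. -/
def ExpIntegrable {X Ω : Type*} [MeasurableSpace X] [MeasurableSpace Ω]
    (π : Measure X) (P : Measure Ω) (r : X → ℝ) (ε : Ω → X → ℝ) : Prop :=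
  ∀ ν : Measure X, IsProbabilityMeasure ν → ν ≪ π →
    ∫⁻ x, ∫⁻ ω, ENNReal.ofReal (Real.exp |r x + ε ω x|) ∂P ∂ν < ∞

/-- The heterogeneity-averaged utility `Q(x) = e^{r(x)} E[e^{ε(X)} | X = x] = E[e^{r(x) + ε(x)}]`,
where the random field `ε` is independent of `X`. -/
noncomputable def utility {X Ω : Type*} [MeasurableSpace Ω]
    (P : Measure Ω) (r : X → ℝ) (ε : Ω → X → ℝ) (x : X) : ℝ≥0∞ :=
  ∫⁻ ω, ENNReal.ofReal (Real.exp (r x + ε ω x)) ∂P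

/-- `Q_* = ess sup Q` with respect to the baseline measure `π`. -/
noncomputable def utilityMax {X Ω : Type*} [MeasurableSpace X] [MeasurableSpace Ω]
    (π : Measure X) (P : Measure Ω) (r : X → ℝ) (ε : Ω → X → ℝ) : ℝ≥0∞ :=
  essSup (utility P r ε) π

/-- Nondegenerate fixed point condition `α > (∫ Q_* / (Q_* - Q) dP_ref)⁻¹`. The integrand is `∞`
where `Q = Q_*`, and the inverse of an infinite integral is `0`. -/
def Nondegenerate {X Ω : Type*} [MeasurableSpace X] [MeasurableSpace Ω]
    (π : Measure X) (P : Measure Ω) (r : X → ℝ) (ε : Ω → X → ℝ) (pref : X → ℝ) (α : ℝ) : Prop :=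
  (∫⁻ x, utilityMax π P r ε / (utilityMax π P r ε - utility P r ε x)
    ∂(densityMeasure π pref))⁻¹ < ENNReal.ofReal α

/-- The update `w ↦ α + (1 - α) Q w / ⟨w, Q⟩` with `⟨w, Q⟩ = ∫ w Q dμ`. -/
noncomputable def mixMap {X : Type*} [MeasurableSpace X] (μ : Measure X) (α : ℝ) (Q : X → ℝ)
    (w : X → ℝ) : X → ℝ :=
  fun x => α + (1 - α) * (Q x * w x / ∫ y, w y * Q y ∂μ)

/-- The perturbed update `𝔏_{Δr}` on densities with respect to `P_ref`; its utility is
`Q_{Δr}(x) = e^{r(x) + Δr(x)} E[e^{ε(X)} | X = x]`. -/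
noncomputable def perturbedMap {X Ω : Type*} [MeasurableSpace X] [MeasurableSpace Ω]
    (π : Measure X) (P : Measure Ω) (r : X → ℝ) (ε : Ω → X → ℝ) (pref : X → ℝ) (α : ℝ)
    (Δr : Lp ℝ ∞ π) : (X → ℝ) → X → ℝ :=
  mixMap (densityMeasure π pref) α fun x => (utility P (fun y => r y + Δr y) ε x).toReal

/-- Total variation distance `½ ∫ |u - v| dμ` of densities with respect to `μ`. -/
noncomputable def dTV {X : Type*} [MeasurableSpace X] (μ : Measure X) (u v : X → ℝ) : ℝ≥0∞ :=
  2⁻¹ * ∫⁻ x, ENNReal.ofReal |u x - v x| ∂μ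

/-- `w` is a limit of the sequence `u` in the space of probability densities with respect to `μ`,
with the total variation metric. -/
def IsTVLimit {X : Type*} [MeasurableSpace X] (μ : Measure X) (u : ℕ → X → ℝ) (w : X → ℝ) : Prop :=
  IsDensity μ w ∧ Tendsto (fun n => dTV μ (u n) w) atTop (𝓝 0)

open Classical in
/-- The total variation limit of `u` (unique up to `μ`-a.e. equality), and `0` if there is none. -/
noncomputable def limTV {X : Type*} [MeasurableSpace X] (μ : Measure X) (u : ℕ → X → ℝ) : X → ℝ :=
  if h : ∃ w, IsTVLimit μ u w then h.choose else 0

/-- `𝔏_{Δr}^n w₀` for `n ∈ ℕ ∪ {∞}`; for `n = ∞` it is the limit of the sequence. -/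
noncomputable def trajectory {X Ω : Type*} [MeasurableSpace X] [MeasurableSpace Ω]
    (π : Measure X) (P : Measure Ω) (r : X → ℝ) (ε : Ω → X → ℝ) (pref : X → ℝ) (α : ℝ)
    (w₀ : X → ℝ) (Δr : Lp ℝ ∞ π) : ℕ∞ → X → ℝ
  | ⊤ => limTV (densityMeasure π pref) fun n => (perturbedMap π P r ε pref α Δr)^[n] w₀
  | (n : ℕ) => (perturbedMap π P r ε pref α Δr)^[n] w₀

/-!
The update `L w = α + (1 - α) Q w / ⟨w, Q⟩` is nonlinear only through a normalisation: `L w` is the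
unit mass multiple of `T w`, where `T u = Q u + α / (1 - α) ⟨u, Q⟩` is a positive linear operator
(`linearUpdate`). Its adjoint has the eigenvector `φ = Q / (λ - Q)` (`dualWeight`) with eigenvalue
`λ > ess sup Q` as soon as `∫ φ dμ = (1 - α) / α`, and the nondegeneracy condition guarantees that
such a `λ` exists: the mass of `φ` exceeds `(1 - α) / α` for `λ` close to `Q_*` (Fatou's lemma,
`Nondegenerate.exists_le_integral_dualWeight`) and decreases continuously to zero
(`BoundedUtility.exists_integral_dualWeight_eq`).

Conjugated by `φ`, the operator `T / λ` is the transition operator of a Markov chain that stays at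
`x` with probability `Q x / λ` and otherwise jumps to a point drawn from a fixed law. The jump
probability is at least `1 - B / λ` if `Q ≤ B < λ`, so this is a Doeblin chain. Consequently the
distance `dualDist`, the `φ`-weighted `L¹` distance of densities rescaled to `∫ φ w = 1`, is
contracted by the factor `B / λ` (`BoundedUtility.dualDist_mixMap_le`), and it controls the total
variation distance one step later (`BoundedUtility.dTV_mixMap_le`). The iterates thus converge
geometrically to the fixed point `α λ / (λ - Q)`, at a rate that depends on the utility only through
`B` and a lower bound for `λ` (`BoundedUtility.exists_dTV_iterate_le`).

A perturbation with `‖Δr‖ ≤ log s` changes `Q` by factors in `[s⁻¹, s]`. With `s ^ 4 Q_*` a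
spectral parameter at which the unperturbed `φ` has enough mass, the bounds `B = s Q_*` and
`λ ≥ s ^ 3 Q_*` hold for all these perturbations at once, so the rate is uniform
(`BoundedUtility.exists_rate`). Finitely many steps depend continuously on `Δr`
(`BoundedUtility.tendsto_dTV_iterate`), and the common rate takes care of all later times, the
limit included (`tendsto_iSup_dTV`).
-/

/-! ### Probability densities and the total variation distance -/

section Density

variable {X : Type*} [MeasurableSpace X] {μ : Measure X}

lemma IsDensity.integrable {w : X → ℝ} (hw : IsDensity μ w) : Integrable w μ := by
  refine ⟨hw.1.aestronglyMeasurable, ?_⟩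
  rw [hasFiniteIntegral_iff_ofReal (Eventually.of_forall hw.2.1), hw.2.2]
  exact ENNReal.one_lt_top

lemma IsDensity.integral_eq_one {w : X → ℝ} (hw : IsDensity μ w) : ∫ x, w x ∂μ = 1 := by
  rw [integral_eq_lintegral_of_nonneg_ae (Eventually.of_forall hw.2.1)
    hw.1.aestronglyMeasurable, hw.2.2, ENNReal.toReal_one]

lemma isDensity_of_integral_eq_one {w : X → ℝ} (hm : Measurable w) (h0 : ∀ x, 0 ≤ w x)
    (hi : Integrable w μ) (h1 : ∫ x, w x ∂μ = 1) : IsDensity μ w :=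
  ⟨hm, h0, by rw [← ofReal_integral_eq_lintegral_ofReal hi (Eventually.of_forall h0), h1,
    ENNReal.ofReal_one]⟩

lemma dTV_comm (u v : X → ℝ) : dTV μ u v = dTV μ v u := by
  simp only [dTV, abs_sub_comm]

lemma dTV_triangle {u v w : X → ℝ} (hu : Measurable u) (hv : Measurable v) :
    dTV μ u w ≤ dTV μ u v + dTV μ v w := by
  unfold dTV
  rw [← mul_add, ← lintegral_add_left (by fun_prop)]
  gcongr with x
  rw [← ENNReal.ofReal_add (abs_nonneg _) (abs_nonneg _)]
  exact ENNReal.ofReal_le_ofReal (abs_sub_le _ _ _)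

lemma dTV_eq_ofReal {u v : X → ℝ} (hu : Integrable u μ) (hv : Integrable v μ) :
    dTV μ u v = ENNReal.ofReal (2⁻¹ * ∫ x, |u x - v x| ∂μ) := by
  have hi : Integrable (fun x => |u x - v x|) μ := (hu.sub hv).abs
  rw [dTV, ENNReal.ofReal_mul (by norm_num), ofReal_integral_eq_lintegral_ofReal
    hi (Eventually.of_forall fun _ => abs_nonneg _),
    ENNReal.ofReal_inv_of_pos (by norm_num), ENNReal.ofReal_ofNat]

/-- Normalising two nonnegative functions to unit mass at most doubles their relative
`L¹` distance. -/
lemma integral_abs_div_sub_div_le {a b : X → ℝ} (ha : Integrable a μ) (hb : Integrable b μ)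
    (ha0 : 0 ≤ᵐ[μ] a) (hA : 0 < ∫ x, a x ∂μ) (hB : 0 < ∫ x, b x ∂μ) :
    ∫ x, |a x / (∫ y, a y ∂μ) - b x / ∫ y, b y ∂μ| ∂μ
      ≤ 2 / (∫ y, b y ∂μ) * ∫ x, |a x - b x| ∂μ := by
  set A := ∫ y, a y ∂μ with hAdef
  set C := ∫ y, b y ∂μ with hCdef
  set D := ∫ x, |a x - b x| ∂μ with hD
  have hAC : |A - C| ≤ D := by
    rw [hAdef, hCdef, ← integral_sub ha hb]
    exact abs_integral_le_integral_abs
  have hpt : ∀ᵐ x ∂μ, |a x / A - b x / C| ≤ C⁻¹ * |a x - b x| + |A - C| / (A * C) * a x := by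
    filter_upwards [ha0] with x hx
    have hx : 0 ≤ a x := hx
    have : a x / A - b x / C = C⁻¹ * (a x - b x) - (A - C) / (A * C) * a x := by
      field_simp; ring
    rw [this]
    refine (abs_sub _ _).trans ?_
    rw [abs_mul, abs_mul, abs_div, abs_of_pos (inv_pos.2 hB), abs_of_pos (mul_pos hA hB),
      abs_of_nonneg hx]
  have hi : Integrable (fun x => |a x - b x|) μ := (ha.sub hb).abs
  calc ∫ x, |a x / A - b x / C| ∂μ
      ≤ ∫ x, (C⁻¹ * |a x - b x| + |A - C| / (A * C) * a x) ∂μ :=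
        integral_mono_ae ((ha.div_const A).sub (hb.div_const C)).abs
          ((hi.const_mul _).add (ha.const_mul _)) hpt
    _ = C⁻¹ * D + |A - C| / C := by
        rw [integral_add (hi.const_mul _) (ha.const_mul _), integral_const_mul,
          integral_const_mul, ← hAdef, ← hD]
        field_simp
    _ ≤ C⁻¹ * D + D / C := by gcongr
    _ = 2 / C * D := by field_simp; ring

end Density

/-! ### The update for a bounded utility -/

/-- A nonnegative measurable utility that is `μ`-almost everywhere positive and at most `B`. -/
structure BoundedUtility {X : Type*} [MeasurableSpace X] (μ : Measure X) (Q : X → ℝ) (B : ℝ) :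
    Prop where
  meas : Measurable Q
  nonneg : ∀ x, 0 ≤ Q x
  pos : ∀ᵐ x ∂μ, 0 < Q x
  le : ∀ᵐ x ∂μ, Q x ≤ B

section Update

variable {X : Type*} [MeasurableSpace X] {μ : Measure X} {Q w : X → ℝ} {B α : ℝ}

lemma BoundedUtility.integrable_mul (hQ : BoundedUtility μ Q B) (hw : Integrable w μ) :
    Integrable (fun x => Q x * w x) μ := by
  refine hw.bdd_mul (c := B) hQ.meas.aestronglyMeasurable ?_
  filter_upwards [hQ.le] with x hx
  rwa [Real.norm_of_nonneg (hQ.nonneg x)]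

/-- A function that is positive almost everywhere has positive integral against a density. -/
lemma IsDensity.integral_mul_pos (hw : IsDensity μ w) {f : X → ℝ} (hf : ∀ᵐ x ∂μ, 0 < f x)
    (hi : Integrable (fun x => f x * w x) μ) : 0 < ∫ x, f x * w x ∂μ := by
  rw [integral_pos_iff_support_of_nonneg_ae
    (by filter_upwards [hf] with x hx using mul_nonneg hx.le (hw.2.1 x)) hi, pos_iff_ne_zero]
  intro h0
  have h1 : w =ᵐ[μ] 0 := by
    filter_upwards [measure_eq_zero_iff_ae_notMem.1 h0, hf] with x hx hx'
    simpa [hx'.ne'] using hx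
  have := hw.integral_eq_one
  rw [integral_congr_ae h1] at this
  simp at this

lemma BoundedUtility.integral_pos (hQ : BoundedUtility μ Q B) (hw : IsDensity μ w) :
    0 < ∫ x, Q x * w x ∂μ :=
  hw.integral_mul_pos hQ.pos (hQ.integrable_mul hw.integrable)

lemma mixMap_apply (x : X) :
    mixMap μ α Q w x = α + (1 - α) * (Q x * w x / ∫ y, Q y * w y ∂μ) := by
  simp only [mixMap, mul_comm]

lemma BoundedUtility.isDensity_mixMap [IsProbabilityMeasure μ] (hQ : BoundedUtility μ Q B)
    (hα₀ : 0 < α) (hα₁ : α < 1) (hw : IsDensity μ w) : IsDensity μ (mixMap μ α Q w) := by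
  have hz := hQ.integral_pos hw
  have hi := hQ.integrable_mul hw.integrable
  have hm := hQ.meas
  have hwm := hw.1
  have e : mixMap μ α Q w = fun x => α + (1 - α) * (Q x * w x / ∫ y, Q y * w y ∂μ) :=
    funext fun x => mixMap_apply x
  have hi' : Integrable (fun x => (1 - α) * (Q x * w x / ∫ y, Q y * w y ∂μ)) μ :=
    (hi.div_const _).const_mul _
  rw [e]
  refine isDensity_of_integral_eq_one (by fun_prop) (fun x => ?_)
    ((integrable_const _).add hi') ?_
  · have := mul_nonneg (hQ.nonneg x) (hw.2.1 x)
    have : 0 ≤ 1 - α := by linarith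
    positivity
  · rw [integral_add (integrable_const _) hi', integral_const_mul, integral_div, div_self hz.ne']
    simp

lemma BoundedUtility.isDensity_iterate [IsProbabilityMeasure μ] (hQ : BoundedUtility μ Q B)
    (hα₀ : 0 < α) (hα₁ : α < 1) (hw : IsDensity μ w) (n : ℕ) :
    IsDensity μ ((mixMap μ α Q)^[n] w) := by
  induction n with
  | zero => exact hw
  | succ n ih =>
    rw [Function.iterate_succ_apply']
    exact hQ.isDensity_mixMap hα₀ hα₁ ih

/-- One step of the update depends continuously on the utility and on the density: if the
utilities `Q` and `Q'` differ by at most `δ`, the error grows by a factor controlled by the mean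
utility of the unperturbed density. -/
lemma BoundedUtility.integral_abs_mixMap_sub_le {Q' w' : X → ℝ} {B' δ : ℝ}
    (hQ : BoundedUtility μ Q B) (hQ' : BoundedUtility μ Q' B')
    (hα₁ : α < 1) (hw : IsDensity μ w) (hw' : IsDensity μ w')
    (hδ : ∀ᵐ x ∂μ, |Q' x - Q x| ≤ δ) :
    ∫ x, |mixMap μ α Q' w' x - mixMap μ α Q w x| ∂μ
      ≤ (1 - α) * (2 / (∫ y, Q y * w y ∂μ) * (B' * (∫ x, |w' x - w x| ∂μ) + δ)) := by
  have hi := hQ.integrable_mul hw.integrable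
  have hi' := hQ'.integrable_mul hw'.integrable
  have hz := hQ.integral_pos hw
  have hz' := hQ'.integral_pos hw'
  have hα : 0 ≤ 1 - α := by linarith
  have e : ∀ x, |mixMap μ α Q' w' x - mixMap μ α Q w x|
      = (1 - α) * |Q' x * w' x / (∫ y, Q' y * w' y ∂μ) - Q x * w x / ∫ y, Q y * w y ∂μ| := by
    intro x
    rw [mixMap_apply, mixMap_apply, add_sub_add_left_eq_sub, ← mul_sub, abs_mul,
      abs_of_nonneg hα]
  simp_rw [e, integral_const_mul]
  gcongr
  refine (integral_abs_div_sub_div_le hi' hi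
    (Eventually.of_forall fun x => mul_nonneg (hQ'.nonneg x) (hw'.2.1 x)) hz' hz).trans ?_
  gcongr
  have hd : Integrable (fun x => |w' x - w x|) μ := (hw'.integrable.sub hw.integrable).abs
  calc ∫ x, |Q' x * w' x - Q x * w x| ∂μ ≤ ∫ x, (B' * |w' x - w x| + δ * w x) ∂μ := by
        refine integral_mono_ae (hi'.sub hi).abs
          ((hd.const_mul _).add (hw.integrable.const_mul _)) ?_
        filter_upwards [hδ, hQ'.le] with x hx hx'
        have : Q' x * w' x - Q x * w x = Q' x * (w' x - w x) + (Q' x - Q x) * w x := by ring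
        simp only [this]
        refine (abs_add_le _ _).trans ?_
        rw [abs_mul, abs_mul, abs_of_nonneg (hQ'.nonneg x), abs_of_nonneg (hw.2.1 x)]
        have := hw.2.1 x
        gcongr
    _ = _ := by
        rw [integral_add (hd.const_mul _) (hw.integrable.const_mul _), integral_const_mul,
          integral_const_mul, hw.integral_eq_one, mul_one]

end Update

/-! ### The dual eigenvector and the Doeblin contraction -/

/-- The weight `φ = Q / (lam - Q)`, an eigenvector with eigenvalue `lam` of the adjoint of the
linear operator `u ↦ Q u + α / (1 - α) ⟨u, Q⟩` as soon as `∫ φ dμ = (1 - α) / α`. -/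
noncomputable def dualWeight {X : Type*} (lam : ℝ) (Q : X → ℝ) (x : X) : ℝ :=
  Q x / (lam - Q x)

/-- The pairing `∫ φ w dμ` of `w` with the dual weight. -/
noncomputable def dualMass {X : Type*} [MeasurableSpace X] (μ : Measure X) (lam : ℝ)
    (Q w : X → ℝ) : ℝ :=
  ∫ x, dualWeight lam Q x * w x ∂μ

/-- The linear operator `u ↦ Q u + α / (1 - α) ⟨u, Q⟩`; `mixMap` is its normalisation to unit
mass. -/
noncomputable def linearUpdate {X : Type*} [MeasurableSpace X] (μ : Measure X) (α : ℝ)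
    (Q u : X → ℝ) (x : X) : ℝ :=
  Q x * u x + α / (1 - α) * ∫ y, Q y * u y ∂μ

/-- The `φ`-weighted `L¹` distance of `w` and `w'` after both have been scaled to have
`dualMass` one. It is the metric in which the update contracts. -/
noncomputable def dualDist {X : Type*} [MeasurableSpace X] (μ : Measure X) (lam : ℝ)
    (Q w w' : X → ℝ) : ℝ :=
  ∫ x, dualWeight lam Q x * |w x / dualMass μ lam Q w - w' x / dualMass μ lam Q w'| ∂μ

section Contraction

variable {X : Type*} [MeasurableSpace X] {μ : Measure X} {Q w w' u : X → ℝ} {B α lam : ℝ}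

lemma BoundedUtility.bound_pos [NeZero μ] (hQ : BoundedUtility μ Q B) : 0 < B := by
  obtain ⟨x, hx, hx'⟩ := (hQ.pos.and hQ.le).exists
  exact hx.trans_le hx'

lemma BoundedUtility.measurable_dualWeight (hQ : BoundedUtility μ Q B) :
    Measurable (dualWeight lam Q) :=
  hQ.meas.div (measurable_const.sub hQ.meas)

lemma BoundedUtility.dualWeight_pos (hQ : BoundedUtility μ Q B) (hl : B < lam) :
    ∀ᵐ x ∂μ, 0 < dualWeight lam Q x := by
  filter_upwards [hQ.pos, hQ.le] with x h1 h2
  exact div_pos h1 (by linarith)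

lemma BoundedUtility.dualWeight_le [NeZero μ] (hQ : BoundedUtility μ Q B) (hl : B < lam) :
    ∀ᵐ x ∂μ, dualWeight lam Q x ≤ B / (lam - B) := by
  have hB := hQ.bound_pos
  filter_upwards [hQ.le] with x h2
  have := hQ.nonneg x
  have : 0 < lam - B := by linarith
  unfold dualWeight
  gcongr

lemma BoundedUtility.integrable_dualWeight_mul [NeZero μ] (hQ : BoundedUtility μ Q B)
    (hl : B < lam) (hu : Integrable u μ) : Integrable (fun x => dualWeight lam Q x * u x) μ := by
  refine hu.bdd_mul (c := B / (lam - B)) hQ.measurable_dualWeight.aestronglyMeasurable ?_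
  filter_upwards [hQ.dualWeight_le hl, hQ.dualWeight_pos hl] with x hx hx'
  rwa [Real.norm_of_nonneg hx'.le]

lemma BoundedUtility.dualMass_pos [NeZero μ] (hQ : BoundedUtility μ Q B) (hl : B < lam)
    (hw : IsDensity μ w) : 0 < dualMass μ lam Q w :=
  hw.integral_mul_pos (hQ.dualWeight_pos hl) (hQ.integrable_dualWeight_mul hl hw.integrable)

lemma BoundedUtility.dualMass_le [NeZero μ] (hQ : BoundedUtility μ Q B) (hl : B < lam)
    (hw : IsDensity μ w) : dualMass μ lam Q w ≤ B / (lam - B) := by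
  rw [← mul_one (B / (lam - B)), ← hw.integral_eq_one, ← integral_const_mul]
  refine integral_mono_ae (hQ.integrable_dualWeight_mul hl hw.integrable)
    (hw.integrable.const_mul _) ?_
  filter_upwards [hQ.dualWeight_le hl] with x hx
  exact mul_le_mul_of_nonneg_right hx (hw.2.1 x)

lemma BoundedUtility.dualDist_nonneg (hQ : BoundedUtility μ Q B) (hl : B < lam) :
    0 ≤ dualDist μ lam Q w w' := by
  refine integral_nonneg_of_ae ?_
  filter_upwards [hQ.dualWeight_pos hl] with x hx
  exact mul_nonneg hx.le (abs_nonneg _)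

lemma BoundedUtility.linearUpdate_eq_mixMap (hQ : BoundedUtility μ Q B) (hα₁ : α < 1)
    (hw : IsDensity μ w) (x : X) :
    linearUpdate μ α Q w x = (∫ y, Q y * w y ∂μ) / (1 - α) * mixMap μ α Q w x := by
  have hz := hQ.integral_pos hw
  have : 1 - α ≠ 0 := by linarith
  rw [mixMap_apply, linearUpdate]
  field_simp
  ring

variable [IsProbabilityMeasure μ]

lemma BoundedUtility.integrable_linearUpdate (hQ : BoundedUtility μ Q B) (hu : Integrable u μ) :
    Integrable (linearUpdate μ α Q u) μ :=
  (hQ.integrable_mul hu).add (integrable_const _)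

/-- `φ` is an eigenvector of the adjoint of the linear update. -/
lemma BoundedUtility.dualMass_linearUpdate (hQ : BoundedUtility μ Q B) (hl : B < lam)
    (hα₀ : 0 < α) (hα₁ : α < 1) (hlam : ∫ x, dualWeight lam Q x ∂μ = (1 - α) / α)
    (hu : Integrable u μ) :
    dualMass μ lam Q (linearUpdate μ α Q u) = lam * dualMass μ lam Q u := by
  have hQu := hQ.integrable_mul hu
  have h1 := hQ.integrable_dualWeight_mul hl hQu
  have h2 : Integrable (dualWeight lam Q) μ := by
    simpa using hQ.integrable_dualWeight_mul hl (integrable_const (1 : ℝ))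
  have hα : 1 - α ≠ 0 := by linarith
  simp only [dualMass, linearUpdate, mul_add]
  rw [integral_add h1 (h2.mul_const _), integral_mul_const, hlam]
  have : (1 - α) / α * (α / (1 - α) * ∫ y, Q y * u y ∂μ) = ∫ y, Q y * u y ∂μ := by field_simp
  rw [this, ← integral_const_mul, ← integral_add h1 hQu]
  refine integral_congr_ae ?_
  filter_upwards [hQ.le] with x hx
  have : lam - Q x ≠ 0 := by linarith
  unfold dualWeight
  field_simp
  ring

/-- On functions that `φ` annihilates the linear update contracts the `φ`-weighted `L¹` norm,
relative to its eigenvalue `lam > B`. -/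
lemma BoundedUtility.integral_dualWeight_mul_abs_linearUpdate_le (hQ : BoundedUtility μ Q B)
    (hl : B < lam) (hα₀ : 0 < α) (hα₁ : α < 1)
    (hlam : ∫ x, dualWeight lam Q x ∂μ = (1 - α) / α)
    (hu : Integrable u μ) (hu0 : dualMass μ lam Q u = 0) :
    ∫ x, dualWeight lam Q x * |linearUpdate μ α Q u x| ∂μ
      ≤ B * ∫ x, dualWeight lam Q x * |u x| ∂μ := by
  have hQu := hQ.integrable_mul hu
  have hφu := hQ.integrable_dualWeight_mul hl hu
  have hφu' := hQ.integrable_dualWeight_mul hl hu.abs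
  have hQφu' := hQ.integrable_mul hφu'
  have h2 : Integrable (dualWeight lam Q) μ := by
    simpa using hQ.integrable_dualWeight_mul hl (integrable_const (1 : ℝ))
  have hα : 0 < 1 - α := by linarith
  -- `⟨Q, u⟩ = ⟨(lam - Q) φ, u⟩`, and a multiple of `⟨φ, u⟩ = 0` may be subtracted.
  have hz : |∫ y, Q y * u y ∂μ|
      ≤ B * (∫ x, dualWeight lam Q x * |u x| ∂μ)
        - ∫ x, Q x * (dualWeight lam Q x * |u x|) ∂μ := by
    have e : ∫ y, Q y * u y ∂μ
        = ∫ y, (Q y * u y - (lam - B) * (dualWeight lam Q y * u y)) ∂μ := by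
      have hu0' : ∫ y, dualWeight lam Q y * u y ∂μ = 0 := hu0
      rw [integral_sub hQu (hφu.const_mul _), integral_const_mul, hu0']
      ring
    rw [e, ← integral_const_mul, ← integral_sub (hφu'.const_mul _) hQφu']
    refine abs_integral_le_integral_abs.trans (integral_mono_ae
      (hQu.sub (hφu.const_mul _)).abs ((hφu'.const_mul _).sub hQφu') ?_)
    filter_upwards [hQ.le, hQ.dualWeight_pos hl] with x hx hx'
    have h3 : lam - Q x ≠ 0 := by linarith
    have : Q x * u x - (lam - B) * (dualWeight lam Q x * u x)
        = (B - Q x) * dualWeight lam Q x * u x := by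
      unfold dualWeight; field_simp; ring
    simp only [this, abs_mul, abs_of_pos hx', abs_of_nonneg (sub_nonneg.2 hx)]
    apply le_of_eq; ring
  calc ∫ x, dualWeight lam Q x * |linearUpdate μ α Q u x| ∂μ
      ≤ ∫ x, (Q x * (dualWeight lam Q x * |u x|)
          + dualWeight lam Q x * (α / (1 - α) * |∫ y, Q y * u y ∂μ|)) ∂μ := by
        refine integral_mono_ae
          (hQ.integrable_dualWeight_mul hl (hQ.integrable_linearUpdate hu).abs)
          (hQφu'.add (h2.mul_const _)) ?_
        filter_upwards [hQ.dualWeight_pos hl] with x hx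
        have h3 : |linearUpdate μ α Q u x| ≤ Q x * |u x| + α / (1 - α) * |∫ y, Q y * u y ∂μ| := by
          refine (abs_add_le _ _).trans ?_
          rw [abs_mul, abs_mul, abs_of_nonneg (hQ.nonneg x), abs_of_pos (div_pos hα₀ hα)]
        calc _ ≤ _ := mul_le_mul_of_nonneg_left h3 hx.le
          _ = _ := by ring
    _ = (∫ x, Q x * (dualWeight lam Q x * |u x|) ∂μ) + |∫ y, Q y * u y ∂μ| := by
        rw [integral_add hQφu' (h2.mul_const _), integral_mul_const, hlam]
        field_simp
    _ ≤ _ := by linarith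

/-- The linear update is bounded from the `φ`-weighted `L¹` norm to the `L¹` norm, although `φ`
need not be bounded away from zero: it depends on `u` only through `Q u ≤ lam φ u`. -/
lemma BoundedUtility.integral_abs_linearUpdate_le (hQ : BoundedUtility μ Q B)
    (hl : B < lam) (hα₀ : 0 < α) (hα₁ : α < 1) (hu : Integrable u μ) :
    ∫ x, |linearUpdate μ α Q u x| ∂μ
      ≤ lam / (1 - α) * ∫ x, dualWeight lam Q x * |u x| ∂μ := by
  have hQu := hQ.integrable_mul hu
  have hQu' := hQ.integrable_mul hu.abs
  have hα : 0 < 1 - α := by linarith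
  have h1 : ∫ x, |linearUpdate μ α Q u x| ∂μ
      ≤ (∫ x, Q x * |u x| ∂μ) + α / (1 - α) * |∫ y, Q y * u y ∂μ| := by
    calc ∫ x, |linearUpdate μ α Q u x| ∂μ
        ≤ ∫ x, (Q x * |u x| + α / (1 - α) * |∫ y, Q y * u y ∂μ|) ∂μ := by
          refine integral_mono (hQ.integrable_linearUpdate hu).abs
            (hQu'.add (integrable_const _)) fun x => ?_
          refine (abs_add_le _ _).trans ?_
          rw [abs_mul, abs_mul, abs_of_nonneg (hQ.nonneg x), abs_of_pos (div_pos hα₀ hα)]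
      _ = _ := by rw [integral_add hQu' (integrable_const _)]; simp
  have h2 : |∫ y, Q y * u y ∂μ| ≤ ∫ x, Q x * |u x| ∂μ := by
    refine abs_integral_le_integral_abs.trans (le_of_eq (integral_congr_ae ?_))
    exact Eventually.of_forall fun x => by simp only [abs_mul, abs_of_nonneg (hQ.nonneg x)]
  have h3 : ∫ x, Q x * |u x| ∂μ ≤ lam * ∫ x, dualWeight lam Q x * |u x| ∂μ := by
    rw [← integral_const_mul]
    refine integral_mono_ae hQu' ((hQ.integrable_dualWeight_mul hl hu.abs).const_mul _) ?_
    filter_upwards [hQ.le, hQ.dualWeight_pos hl] with x hx hx'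
    have h4 : lam - Q x ≠ 0 := by linarith
    have h5 : Q x = (lam - Q x) * dualWeight lam Q x := by unfold dualWeight; field_simp
    calc Q x * |u x| = (lam - Q x) * (dualWeight lam Q x * |u x|) := by
          conv_lhs => rw [h5]
          ring
      _ ≤ lam * (dualWeight lam Q x * |u x|) := by
          have := hQ.nonneg x
          gcongr
          linarith
  calc _ ≤ _ := h1
    _ ≤ (∫ x, Q x * |u x| ∂μ) + α / (1 - α) * ∫ x, Q x * |u x| ∂μ := by gcongr
    _ = 1 / (1 - α) * ∫ x, Q x * |u x| ∂μ := by field_simp; ring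
    _ ≤ 1 / (1 - α) * (lam * ∫ x, dualWeight lam Q x * |u x| ∂μ) := by gcongr
    _ = _ := by ring

/-- After scaling to `dualMass` one, the update is the linear update divided by its eigenvalue. -/
lemma BoundedUtility.mixMap_div_dualMass (hQ : BoundedUtility μ Q B) (hl : B < lam)
    (hα₀ : 0 < α) (hα₁ : α < 1) (hlam : ∫ x, dualWeight lam Q x ∂μ = (1 - α) / α)
    (hw : IsDensity μ w) (x : X) :
    mixMap μ α Q w x / dualMass μ lam Q (mixMap μ α Q w)
      = linearUpdate μ α Q (fun x => w x / dualMass μ lam Q w) x / lam := by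
  have hz := hQ.integral_pos hw
  have hm := hQ.dualMass_pos hl hw
  have hm' := hQ.dualMass_pos hl (hQ.isDensity_mixMap hα₀ hα₁ hw)
  have hα : 0 < 1 - α := by linarith
  have hlam0 : 0 < lam := hQ.bound_pos.trans hl
  have h1 := hQ.dualMass_linearUpdate hl hα₀ hα₁ hlam hw.integrable
  have h2 : dualMass μ lam Q (linearUpdate μ α Q w)
      = (∫ y, Q y * w y ∂μ) / (1 - α) * dualMass μ lam Q (mixMap μ α Q w) := by
    simp only [dualMass, hQ.linearUpdate_eq_mixMap hα₁ hw]
    rw [← integral_const_mul]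
    exact integral_congr_ae (Eventually.of_forall fun x => by ring)
  have h3 : linearUpdate μ α Q (fun x => w x / dualMass μ lam Q w) x
      = linearUpdate μ α Q w x / dualMass μ lam Q w := by
    simp only [linearUpdate, ← mul_div_assoc, integral_div]
    ring
  rw [h3, hQ.linearUpdate_eq_mixMap hα₁ hw, div_div, mul_comm _ lam, ← h1, h2]
  field_simp

lemma BoundedUtility.mixMap_div_dualMass_sub (hQ : BoundedUtility μ Q B) (hl : B < lam)
    (hα₀ : 0 < α) (hα₁ : α < 1) (hlam : ∫ x, dualWeight lam Q x ∂μ = (1 - α) / α)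
    (hw : IsDensity μ w) (hw' : IsDensity μ w') (x : X) :
    mixMap μ α Q w x / dualMass μ lam Q (mixMap μ α Q w)
        - mixMap μ α Q w' x / dualMass μ lam Q (mixMap μ α Q w')
      = linearUpdate μ α Q
          (fun x => w x / dualMass μ lam Q w - w' x / dualMass μ lam Q w') x / lam := by
  rw [hQ.mixMap_div_dualMass hl hα₀ hα₁ hlam hw, hQ.mixMap_div_dualMass hl hα₀ hα₁ hlam hw']
  simp only [linearUpdate, mul_sub]
  rw [integral_sub (hQ.integrable_mul (hw.integrable.div_const _))
    (hQ.integrable_mul (hw'.integrable.div_const _))]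
  ring

lemma BoundedUtility.dualMass_sub_eq_zero (hQ : BoundedUtility μ Q B) (hl : B < lam)
    (hw : IsDensity μ w) (hw' : IsDensity μ w') :
    dualMass μ lam Q
      (fun x => w x / dualMass μ lam Q w - w' x / dualMass μ lam Q w') = 0 := by
  have h (v : X → ℝ) (hv : IsDensity μ v) :
      ∫ x, dualWeight lam Q x * (v x / dualMass μ lam Q v) ∂μ = 1 := by
    simp only [← mul_div_assoc, integral_div]
    exact div_self (hQ.dualMass_pos hl hv).ne'
  simp only [dualMass, mul_sub] at h ⊢
  rw [integral_sub (hQ.integrable_dualWeight_mul hl (hw.integrable.div_const _))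
    (hQ.integrable_dualWeight_mul hl (hw'.integrable.div_const _)), h w hw, h w' hw', sub_self]

lemma BoundedUtility.dualDist_le_two (hQ : BoundedUtility μ Q B) (hl : B < lam)
    (hw : IsDensity μ w) (hw' : IsDensity μ w') : dualDist μ lam Q w w' ≤ 2 := by
  have hi (v : X → ℝ) (hv : IsDensity μ v) :=
    hQ.integrable_dualWeight_mul hl (hv.integrable.div_const (dualMass μ lam Q v))
  have h (v : X → ℝ) (hv : IsDensity μ v) :
      ∫ x, dualWeight lam Q x * (v x / dualMass μ lam Q v) ∂μ = 1 := by
    simp only [← mul_div_assoc, integral_div]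
    exact div_self (hQ.dualMass_pos hl hv).ne'
  calc dualDist μ lam Q w w'
      ≤ ∫ x, (dualWeight lam Q x * (w x / dualMass μ lam Q w)
          + dualWeight lam Q x * (w' x / dualMass μ lam Q w')) ∂μ := by
        refine integral_mono_ae (hQ.integrable_dualWeight_mul hl
          ((hw.integrable.div_const _).sub (hw'.integrable.div_const _)).abs)
          ((hi w hw).add (hi w' hw')) ?_
        filter_upwards [hQ.dualWeight_pos hl] with x hx
        have h1 : 0 ≤ w x / dualMass μ lam Q w := div_nonneg (hw.2.1 x) (hQ.dualMass_pos hl hw).le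
        have h2 : 0 ≤ w' x / dualMass μ lam Q w' :=
          div_nonneg (hw'.2.1 x) (hQ.dualMass_pos hl hw').le
        rw [← mul_add]
        refine mul_le_mul_of_nonneg_left ((abs_sub _ _).trans ?_) hx.le
        rw [abs_of_nonneg h1, abs_of_nonneg h2]
    _ = 2 := by rw [integral_add (hi w hw) (hi w' hw'), h w hw, h w' hw']; norm_num

/-- The Doeblin contraction: the update contracts `dualDist` by the factor `B / lam < 1`. -/
lemma BoundedUtility.dualDist_mixMap_le (hQ : BoundedUtility μ Q B) (hl : B < lam)
    (hα₀ : 0 < α) (hα₁ : α < 1) (hlam : ∫ x, dualWeight lam Q x ∂μ = (1 - α) / α)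
    (hw : IsDensity μ w) (hw' : IsDensity μ w') :
    dualDist μ lam Q (mixMap μ α Q w) (mixMap μ α Q w') ≤ B / lam * dualDist μ lam Q w w' := by
  have hlam0 : 0 < lam := hQ.bound_pos.trans hl
  have h := hQ.integral_dualWeight_mul_abs_linearUpdate_le hl hα₀ hα₁ hlam
    ((hw.integrable.div_const (dualMass μ lam Q w)).sub
      (hw'.integrable.div_const (dualMass μ lam Q w')))
    (hQ.dualMass_sub_eq_zero hl hw hw')
  unfold dualDist
  simp only [hQ.mixMap_div_dualMass_sub hl hα₀ hα₁ hlam hw hw', abs_div, abs_of_pos hlam0,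
    ← mul_div_assoc, integral_div]
  rw [div_mul_eq_mul_div]
  exact div_le_div_of_nonneg_right h hlam0.le

/-- After one step of the update the total variation distance is controlled by `dualDist`. -/
lemma BoundedUtility.dTV_mixMap_le (hQ : BoundedUtility μ Q B) (hl : B < lam)
    (hα₀ : 0 < α) (hα₁ : α < 1) (hlam : ∫ x, dualWeight lam Q x ∂μ = (1 - α) / α)
    (hw : IsDensity μ w) (hw' : IsDensity μ w') :
    dTV μ (mixMap μ α Q w) (mixMap μ α Q w')
      ≤ ENNReal.ofReal (B / (lam - B) / (1 - α) * dualDist μ lam Q w w') := by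
  have hlam0 : 0 < lam := hQ.bound_pos.trans hl
  have hα : 0 < 1 - α := by linarith
  have hD := hQ.dualDist_nonneg hl (w := w) (w' := w')
  set a := mixMap μ α Q w with hadef
  set b := mixMap μ α Q w' with hbdef
  have ha : IsDensity μ a := hQ.isDensity_mixMap hα₀ hα₁ hw
  have hb : IsDensity μ b := hQ.isDensity_mixMap hα₀ hα₁ hw'
  have hma := hQ.dualMass_pos hl ha
  have hmb := hQ.dualMass_pos hl hb
  rw [dTV_eq_ofReal ha.integrable hb.integrable]
  refine ENNReal.ofReal_le_ofReal ?_
  have hIa : ∫ x, a x / dualMass μ lam Q a ∂μ = 1 / dualMass μ lam Q a := by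
    rw [integral_div, ha.integral_eq_one]
  have hIb : ∫ x, b x / dualMass μ lam Q b ∂μ = 1 / dualMass μ lam Q b := by
    rw [integral_div, hb.integral_eq_one]
  have h := integral_abs_div_sub_div_le (ha.integrable.div_const (dualMass μ lam Q a))
    (hb.integrable.div_const (dualMass μ lam Q b))
    (Eventually.of_forall fun x => div_nonneg (ha.2.1 x) hma.le)
    (by rw [hIa]; positivity) (by rw [hIb]; positivity)
  rw [hIa, hIb] at h
  have e : ∀ x, a x / dualMass μ lam Q a / (1 / dualMass μ lam Q a)
      - b x / dualMass μ lam Q b / (1 / dualMass μ lam Q b) = a x - b x := by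
    intro x; field_simp
  simp only [e] at h
  have h' : ∫ x, |a x / dualMass μ lam Q a - b x / dualMass μ lam Q b| ∂μ
      ≤ 1 / (1 - α) * dualDist μ lam Q w w' := by
    simp only [hadef, hbdef, hQ.mixMap_div_dualMass_sub hl hα₀ hα₁ hlam hw hw', abs_div,
      abs_of_pos hlam0, integral_div]
    rw [div_le_iff₀ hlam0]
    refine (hQ.integral_abs_linearUpdate_le
      (u := fun x => w x / dualMass μ lam Q w - w' x / dualMass μ lam Q w') hl hα₀ hα₁
      ((hw.integrable.div_const _).sub (hw'.integrable.div_const _))).trans (le_of_eq ?_)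
    unfold dualDist
    ring
  calc 2⁻¹ * ∫ x, |a x - b x| ∂μ
      ≤ 2⁻¹ * (2 / (1 / dualMass μ lam Q b) * (1 / (1 - α) * dualDist μ lam Q w w')) := by
        refine mul_le_mul_of_nonneg_left (h.trans ?_) (by norm_num)
        exact mul_le_mul_of_nonneg_left h' (by positivity)
    _ = dualMass μ lam Q b / (1 - α) * dualDist μ lam Q w w' := by field_simp
    _ ≤ _ := by
        gcongr
        exact hQ.dualMass_le hl hb

end Contraction

/-! ### Geometric convergence to the fixed point -/

section Convergence

variable {X : Type*} [MeasurableSpace X] {μ : Measure X} {Q w w' : X → ℝ} {B α lam : ℝ}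

lemma dTV_congr {u u' v v' : X → ℝ} (hu : u =ᵐ[μ] u') (hv : v =ᵐ[μ] v') :
    dTV μ u v = dTV μ u' v' := by
  unfold dTV
  congr 1
  refine lintegral_congr_ae ?_
  filter_upwards [hu, hv] with x h1 h2
  rw [h1, h2]

lemma mixMap_congr_ae (h : w =ᵐ[μ] w') : mixMap μ α Q w =ᵐ[μ] mixMap μ α Q w' := by
  have h' : ∫ y, w y * Q y ∂μ = ∫ y, w' y * Q y ∂μ := by
    refine integral_congr_ae ?_
    filter_upwards [h] with x hx
    rw [hx]
  filter_upwards [h] with x hx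
  simp only [mixMap, hx, h']

lemma iterate_mixMap_ae_eq_self (h : mixMap μ α Q w =ᵐ[μ] w) (n : ℕ) :
    (mixMap μ α Q)^[n] w =ᵐ[μ] w := by
  induction n with
  | zero => rfl
  | succ n ih =>
    rw [Function.iterate_succ_apply']
    exact (mixMap_congr_ae ih).trans h

variable [IsProbabilityMeasure μ]

lemma BoundedUtility.integrable_dualWeight (hQ : BoundedUtility μ Q B) (hl : B < lam) :
    Integrable (dualWeight lam Q) μ := by
  simpa using hQ.integrable_dualWeight_mul hl (integrable_const (1 : ℝ))

/-- The mass of the dual weight decreases continuously to zero as `lam` grows, so the eigenvalue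
equation has a solution beyond any point where that mass is still large enough. -/
lemma BoundedUtility.exists_integral_dualWeight_eq (hQ : BoundedUtility μ Q B) {lam₁ : ℝ}
    (hl : B < lam₁) (hα₀ : 0 < α) (hα₁ : α < 1)
    (h : (1 - α) / α ≤ ∫ x, dualWeight lam₁ Q x ∂μ) :
    ∃ lam, lam₁ ≤ lam ∧ ∫ x, dualWeight lam Q x ∂μ = (1 - α) / α := by
  have hB := hQ.bound_pos
  have hα : 0 < 1 - α := by linarith
  have hcont : ContinuousOn (fun l => ∫ x, dualWeight l Q x ∂μ)
      (Set.Icc lam₁ (max lam₁ (B / (1 - α)))) := by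
    refine continuousOn_of_dominated (bound := fun _ => B / (lam₁ - B))
      (fun l _ => hQ.measurable_dualWeight.aestronglyMeasurable) (fun l hl' => ?_)
      (integrable_const _) ?_
    · filter_upwards [hQ.dualWeight_le (hl.trans_le hl'.1),
        hQ.dualWeight_pos (hl.trans_le hl'.1)] with x h1 h2
      rw [Real.norm_of_nonneg h2.le]
      refine h1.trans ?_
      have h3 := hl'.1
      have h4 : 0 < lam₁ - B := by linarith
      gcongr
    · filter_upwards [hQ.le] with x hx
      unfold dualWeight
      refine ContinuousOn.div (by fun_prop) (by fun_prop) fun l hl' => ?_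
      have := hl'.1
      linarith
  -- At `lam ≥ B / (1 - α)` the weight is pointwise at most `(1 - α) / α`.
  have hup : ∫ x, dualWeight (max lam₁ (B / (1 - α))) Q x ∂μ ≤ (1 - α) / α := by
    have hl' : B < max lam₁ (B / (1 - α)) := hl.trans_le (le_max_left _ _)
    have h2 : ∫ x, dualWeight (max lam₁ (B / (1 - α))) Q x ∂μ
        ≤ ∫ _, B / (max lam₁ (B / (1 - α)) - B) ∂μ :=
      integral_mono_ae (hQ.integrable_dualWeight hl') (integrable_const _) (hQ.dualWeight_le hl')
    refine h2.trans ?_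
    simp only [integral_const, probReal_univ, smul_eq_mul, one_mul]
    rw [div_le_div_iff₀ (by linarith) hα₀]
    have h3 : B / (1 - α) ≤ max lam₁ (B / (1 - α)) := le_max_right _ _
    rw [div_le_iff₀ hα] at h3
    linarith
  obtain ⟨lam, h1, h2⟩ := intermediate_value_Icc' (le_max_left _ _) hcont ⟨hup, h⟩
  exact ⟨lam, h1.1, h2⟩

/-- The fixed point is `α lam / (lam - Q)`, where `lam` solves the eigenvalue equation. -/
lemma BoundedUtility.exists_fixed_density (hQ : BoundedUtility μ Q B) (hl : B < lam)
    (hα₀ : 0 < α) (hα₁ : α < 1) (hlam : ∫ x, dualWeight lam Q x ∂μ = (1 - α) / α) :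
    ∃ w, IsDensity μ w ∧ mixMap μ α Q w =ᵐ[μ] w := by
  have hα : 0 < 1 - α := by linarith
  have hlam0 : 0 < lam := hQ.bound_pos.trans hl
  have hm := hQ.meas
  have hφ := hQ.integrable_dualWeight hl
  -- Truncation at `B` makes the density nonnegative on the null set where `Q > B`.
  let w : X → ℝ := fun x => α * lam / (lam - min (Q x) B)
  have hw : w =ᵐ[μ] fun x => α * (1 + dualWeight lam Q x) := by
    filter_upwards [hQ.le] with x hx
    have : lam - Q x ≠ 0 := by linarith
    simp only [w, min_eq_left hx, dualWeight]
    field_simp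
    ring
  have hi : Integrable (fun x => α * (1 + dualWeight lam Q x)) μ :=
    ((integrable_const _).add hφ).const_mul _
  have hd : IsDensity μ w := by
    refine isDensity_of_integral_eq_one (by fun_prop) (fun x => ?_) (hi.congr hw.symm) ?_
    · have := min_le_right (Q x) B
      have : 0 ≤ lam - min (Q x) B := by linarith
      positivity
    · rw [integral_congr_ae hw, integral_const_mul, integral_add (integrable_const _) hφ, hlam]
      simp
      field_simp
      ring
  refine ⟨w, hd, ?_⟩
  have hz : ∫ y, Q y * w y ∂μ = (1 - α) * lam := by
    have : ∫ y, Q y * w y ∂μ = ∫ y, α * lam * dualWeight lam Q y ∂μ := by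
      refine integral_congr_ae ?_
      filter_upwards [hQ.le] with x hx
      simp only [w, min_eq_left hx, dualWeight]
      ring
    rw [this, integral_const_mul, hlam]
    field_simp
  filter_upwards [hQ.le] with x hx
  have : lam - Q x ≠ 0 := by linarith
  rw [mixMap_apply, hz]
  simp only [w, min_eq_left hx]
  field_simp
  ring

/-- The iterates converge geometrically to a fixed point, at a rate that depends on the utility
only through the bounds `B < lam₁` and is uniform over the initial densities. -/
lemma BoundedUtility.exists_dTV_iterate_le (hQ : BoundedUtility μ Q B) {lam₁ : ℝ}
    (hl : B < lam₁) (hα₀ : 0 < α) (hα₁ : α < 1)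
    (h : (1 - α) / α ≤ ∫ x, dualWeight lam₁ Q x ∂μ) :
    ∃ w', IsDensity μ w' ∧ ∀ w, IsDensity μ w → ∀ n,
      dTV μ ((mixMap μ α Q)^[n + 1] w) w'
        ≤ ENNReal.ofReal (2 * (B / (lam₁ - B) / (1 - α)) * (B / lam₁) ^ n) := by
  obtain ⟨lam, hlam₁, hlam⟩ := hQ.exists_integral_dualWeight_eq hl hα₀ hα₁ h
  have hl' : B < lam := hl.trans_le hlam₁
  have hB := hQ.bound_pos
  have hα : 0 < 1 - α := by linarith
  have hl1 : 0 < lam₁ := hB.trans hl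
  have hl2 : 0 < lam := hB.trans hl'
  have hl3 : 0 < lam₁ - B := by linarith
  have hl4 : 0 < lam - B := by linarith
  obtain ⟨w', hw', hfix⟩ := hQ.exists_fixed_density hl' hα₀ hα₁ hlam
  refine ⟨w', hw', fun w hw n => ?_⟩
  have hD : ∀ n, dualDist μ lam Q ((mixMap μ α Q)^[n] w) ((mixMap μ α Q)^[n] w')
      ≤ 2 * (B / lam) ^ n := by
    intro n
    induction n with
    | zero => simpa using hQ.dualDist_le_two hl' hw hw'
    | succ n ih =>
      rw [Function.iterate_succ_apply', Function.iterate_succ_apply']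
      refine (hQ.dualDist_mixMap_le hl' hα₀ hα₁ hlam (hQ.isDensity_iterate hα₀ hα₁ hw n)
        (hQ.isDensity_iterate hα₀ hα₁ hw' n)).trans ?_
      calc _ ≤ B / lam * (2 * (B / lam) ^ n) := by gcongr
        _ = _ := by ring
  rw [← dTV_congr (ae_eq_refl _) (iterate_mixMap_ae_eq_self hfix (n + 1)),
    Function.iterate_succ_apply', Function.iterate_succ_apply']
  refine (hQ.dTV_mixMap_le hl' hα₀ hα₁ hlam (hQ.isDensity_iterate hα₀ hα₁ hw n)
    (hQ.isDensity_iterate hα₀ hα₁ hw' n)).trans (ENNReal.ofReal_le_ofReal ?_)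
  calc _ ≤ B / (lam - B) / (1 - α) * (2 * (B / lam) ^ n) := by
        gcongr
        exact hD n
    _ ≤ B / (lam₁ - B) / (1 - α) * (2 * (B / lam₁) ^ n) := by gcongr
    _ = _ := by ring

end Convergence

/-! ### Total variation limits and uniform convergence of families of trajectories -/

section Limits

variable {X : Type*} [MeasurableSpace X] {μ : Measure X}

lemma IsTVLimit.dTV_eq_zero {u : ℕ → X → ℝ} {v w : X → ℝ} (hu : ∀ n, Measurable (u n))
    (hv : IsTVLimit μ u v) (hw : IsTVLimit μ u w) : dTV μ v w = 0 := by
  have h : ∀ n, dTV μ v w ≤ dTV μ (u n) v + dTV μ (u n) w := fun n => by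
    rw [dTV_comm (u n) v]
    exact dTV_triangle hv.1.1 (hu n)
  have := ge_of_tendsto' (hv.2.add hw.2) h
  simpa using this

lemma isTVLimit_limTV {u : ℕ → X → ℝ} (h : ∃ w, IsTVLimit μ u w) :
    IsTVLimit μ u (limTV μ u) := by
  rw [limTV, dif_pos h]
  exact h.choose_spec

/-- A family of trajectories that converges for each finite time, and approaches its limits at
infinite time at a common rate, converges uniformly in time. -/
lemma tendsto_iSup_dTV {ι : Type*} {l : Filter ι} {u : ι → ℕ∞ → X → ℝ} {u₀ : ℕ∞ → X → ℝ}
    {b : ℕ → ℝ≥0∞} (hb : Tendsto b atTop (𝓝 0))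
    (hm : ∀ᶠ i in l, ∀ n, Measurable (u i n)) (hm₀ : ∀ n, Measurable (u₀ n))
    (ht : ∀ᶠ i in l, ∀ n : ℕ, dTV μ (u i (n + 1 : ℕ)) (u i ⊤) ≤ b n)
    (ht₀ : ∀ n : ℕ, dTV μ (u₀ (n + 1 : ℕ)) (u₀ ⊤) ≤ b n)
    (hn : ∀ n : ℕ, Tendsto (fun i => dTV μ (u i n) (u₀ n)) l (𝓝 0)) :
    Tendsto (fun i => ⨆ n, dTV μ (u i n) (u₀ n)) l (𝓝 0) := by
  rw [ENNReal.tendsto_nhds_zero]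
  intro δ hδ
  obtain ⟨c, hc, hfive⟩ : ∃ c : ℝ≥0∞, 0 < c ∧ c + c + c + c + c = δ := by
    refine ⟨δ / 5, ENNReal.div_pos hδ.ne' (by norm_num), ?_⟩
    have : δ / 5 + δ / 5 + δ / 5 + δ / 5 + δ / 5 = 5 * (δ / 5) := by ring
    rw [this, ENNReal.mul_div_cancel (by norm_num) (by norm_num)]
  obtain ⟨N, hN⟩ := eventually_atTop.1 (ENNReal.tendsto_nhds_zero.1 hb _ hc)
  have hfin : ∀ᶠ i in l, ∀ n ∈ Finset.range (N + 2), dTV μ (u i n) (u₀ n) ≤ c :=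
    (Finset.eventually_all _).2 fun n _ => ENNReal.tendsto_nhds_zero.1 (hn n) _ hc
  filter_upwards [hfin, hm, ht] with i hi hmi hti
  have htop : dTV μ (u i ⊤) (u₀ ⊤) ≤ c + (c + c) := by
    refine (dTV_triangle (hmi _) (hmi (N + 1 : ℕ))).trans ?_
    gcongr
    · rw [dTV_comm]
      exact (hti N).trans (hN N le_rfl)
    · refine (dTV_triangle (hmi _) (hm₀ (N + 1 : ℕ))).trans ?_
      gcongr
      · exact hi (N + 1) (by simp)
      · exact (ht₀ N).trans (hN N le_rfl)
  refine iSup_le fun n => ?_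
  induction n using ENat.recTopCoe with
  | top =>
    calc dTV μ (u i ⊤) (u₀ ⊤) ≤ c + (c + c) + (c + c) := htop.trans le_self_add
      _ = δ := by rw [← hfive]; ring
  | coe n =>
    rcases Nat.lt_or_ge n (N + 2) with h | h
    · calc dTV μ (u i n) (u₀ n) ≤ c + (c + c + c + c) :=
            (hi n (Finset.mem_range.2 h)).trans le_self_add
        _ = δ := by rw [← hfive]; ring
    · obtain ⟨m, rfl⟩ : ∃ m, n = m + 1 := ⟨n - 1, by omega⟩
      have hm : N ≤ m := by omega
      calc dTV μ (u i (m + 1 : ℕ)) (u₀ (m + 1 : ℕ))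
          ≤ dTV μ (u i (m + 1 : ℕ)) (u i ⊤)
            + (dTV μ (u i ⊤) (u₀ ⊤) + dTV μ (u₀ ⊤) (u₀ (m + 1 : ℕ))) := by
            refine (dTV_triangle (hmi _) (hmi ⊤)).trans ?_
            gcongr
            exact dTV_triangle (hmi _) (hm₀ _)
        _ ≤ c + (c + (c + c) + c) := by
            gcongr
            · exact (hti m).trans (hN m hm)
            · rw [dTV_comm]
              exact (ht₀ m).trans (hN m hm)
        _ = δ := by rw [← hfive]; ring

end Limits

/-! ### The utility and its perturbations -/

section Utility

variable {X Ω : Type*} [MeasurableSpace Ω] {P : Measure Ω} {r : X → ℝ} {ε : Ω → X → ℝ}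

lemma utility_add (Δ : X → ℝ) (x : X) :
    utility P (fun y => r y + Δ y) ε x = ENNReal.ofReal (Real.exp (Δ x)) * utility P r ε x := by
  rw [utility, utility, ← lintegral_const_mul' _ _ ENNReal.ofReal_ne_top]
  refine lintegral_congr fun ω => ?_
  rw [← ENNReal.ofReal_mul (Real.exp_pos _).le, ← Real.exp_add]
  ring_nf

lemma toReal_utility_add (Δ : X → ℝ) (x : X) :
    (utility P (fun y => r y + Δ y) ε x).toReal
      = Real.exp (Δ x) * (utility P r ε x).toReal := by
  rw [utility_add, ENNReal.toReal_mul, ENNReal.toReal_ofReal (Real.exp_pos _).le]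

variable [MeasurableSpace X] {π : Measure X} [IsProbabilityMeasure P]

lemma measurable_utility (hr : Measurable r) (hε : Measurable (Function.uncurry ε)) :
    Measurable (utility P r ε) := by
  refine Measurable.lintegral_prod_left'
    (f := fun p : Ω × X => ENNReal.ofReal (Real.exp (r p.2 + ε p.1 p.2))) ?_
  exact ((hr.comp measurable_snd).add hε).exp.ennreal_ofReal

lemma utility_pos (hε : Measurable (Function.uncurry ε)) (x : X) : 0 < utility P r ε x := by
  have : Measurable fun ω => ENNReal.ofReal (Real.exp (r x + ε ω x)) :=
    (measurable_const.add (hε.comp (measurable_id.prodMk measurable_const))).exp.ennreal_ofReal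
  rw [utility, lintegral_pos_iff_support this]
  have : (Function.support fun ω => ENNReal.ofReal (Real.exp (r x + ε ω x))) = Set.univ := by
    ext ω
    simp [Real.exp_pos]
  rw [this]
  simp

lemma boundedUtility_utility {μ : Measure X} (hμ : μ ≪ π) (hr : Measurable r)
    (hε : Measurable (Function.uncurry ε)) (hfin : utilityMax π P r ε < ∞) :
    BoundedUtility μ (fun x => (utility P r ε x).toReal) (utilityMax π P r ε).toReal := by
  have hle : ∀ᵐ x ∂μ, utility P r ε x ≤ utilityMax π P r ε := hμ.ae_le ae_le_essSup
  refine ⟨(measurable_utility hr hε).ennreal_toReal, fun _ => ENNReal.toReal_nonneg, ?_, ?_⟩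
  · filter_upwards [hle] with x hx
    exact ENNReal.toReal_pos (utility_pos hε x).ne' (hx.trans_lt hfin).ne
  · filter_upwards [hle] with x hx
    exact ENNReal.toReal_mono hfin.ne hx

end Utility

section Perturbation

variable {X : Type*} [MeasurableSpace X] {μ : Measure X} {Q Δ Δ' : X → ℝ} {B η η' s : ℝ}

lemma BoundedUtility.exp_mul (hQ : BoundedUtility μ Q B) (hΔ : Measurable Δ)
    (hη : ∀ᵐ x ∂μ, |Δ x| ≤ η) (hs : Real.exp η ≤ s) :
    BoundedUtility μ (fun x => Real.exp (Δ x) * Q x) (s * B) := by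
  refine ⟨hΔ.exp.mul hQ.meas, fun x => mul_nonneg (Real.exp_pos _).le (hQ.nonneg x), ?_, ?_⟩
  · filter_upwards [hQ.pos] with x hx
    exact mul_pos (Real.exp_pos _) hx
  · filter_upwards [hQ.le, hη] with x hx h
    have h1 : Real.exp (Δ x) ≤ s := (Real.exp_le_exp.2 ((le_abs_self _).trans h)).trans hs
    exact mul_le_mul h1 hx (hQ.nonneg x) ((Real.exp_pos _).le.trans h1)

lemma BoundedUtility.abs_exp_mul_sub_le (hQ : BoundedUtility μ Q B)
    (hη : ∀ᵐ x ∂μ, |Δ x| ≤ η) (h0 : ∀ᵐ x ∂μ, Δ' x = 0) :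
    ∀ᵐ x ∂μ, |Real.exp (Δ x) * Q x - Real.exp (Δ' x) * Q x| ≤ (Real.exp η - 1) * B := by
  filter_upwards [hQ.le, hη, h0] with x hx h h'
  rw [h', Real.exp_zero, ← sub_mul, abs_mul, abs_of_nonneg (hQ.nonneg x)]
  have h1 : |Real.exp (Δ x) - 1| ≤ Real.exp η - 1 := by
    have h2 := abs_le.1 h
    have h3 := Real.exp_le_exp.2 h2.2
    have h4 := Real.exp_le_exp.2 h2.1
    -- `1 - exp (-η) ≤ exp η - 1` because `exp η + exp (-η) ≥ 2`.
    have h5 : Real.exp η * Real.exp (-η) = 1 := by rw [← Real.exp_add]; simp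
    have h6 : 2 ≤ Real.exp η + Real.exp (-η) := by
      nlinarith [sq_nonneg (Real.exp η - Real.exp (-η)), Real.exp_pos η, Real.exp_pos (-η)]
    exact abs_le.2 ⟨by linarith, by linarith⟩
  exact mul_le_mul h1 hx (hQ.nonneg x) ((abs_nonneg _).trans h1)

/-- The dual weight is increasing in `Q` and scale invariant, so perturbing the utility by a factor
of at least `s⁻¹` costs at most a factor `s` in the spectral parameter. -/
lemma BoundedUtility.integral_dualWeight_le_exp_mul [IsProbabilityMeasure μ]
    (hQ : BoundedUtility μ Q B) (hΔ : Measurable Δ)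
    (hη : ∀ᵐ x ∂μ, |Δ x| ≤ η) (hs1 : 1 < s) (hs : Real.exp η ≤ s) :
    ∫ x, dualWeight (s ^ 4 * B) Q x ∂μ
      ≤ ∫ x, dualWeight (s ^ 3 * B) (fun x => Real.exp (Δ x) * Q x) x ∂μ := by
  have hB := hQ.bound_pos
  have hQ' := hQ.exp_mul hΔ hη hs
  have h1 : 1 < s ^ 4 := one_lt_pow₀ hs1 (by norm_num)
  have h2 : 1 < s ^ 2 := one_lt_pow₀ hs1 (by norm_num)
  have hs0 : 0 < s := by linarith
  have h3 : s * B < s ^ 3 * B := by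
    have : s ^ 3 * B = s ^ 2 * (s * B) := by ring
    rw [this]
    exact lt_mul_of_one_lt_left (by positivity) h2
  refine integral_mono_ae (hQ.integrable_dualWeight (lt_mul_of_one_lt_left hB h1))
    (hQ'.integrable_dualWeight h3) ?_
  filter_upwards [hQ.le, hQ.pos, hQ'.le, hη] with x hx hx0 hx' h
  have h4 : s⁻¹ * Q x ≤ Real.exp (Δ x) * Q x := by
    refine mul_le_mul_of_nonneg_right ?_ hx0.le
    rw [inv_le_comm₀ hs0 (Real.exp_pos _), ← Real.exp_neg]
    exact (Real.exp_le_exp.2 ((neg_le_abs _).trans h)).trans hs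
  have h5 : 0 < s ^ 3 * B - Real.exp (Δ x) * Q x := by linarith
  have h6 : dualWeight (s ^ 4 * B) Q x = s⁻¹ * Q x / (s ^ 3 * B - s⁻¹ * Q x) := by
    have : s ^ 3 * B - s⁻¹ * Q x = s⁻¹ * (s ^ 4 * B - Q x) := by field_simp
    rw [this, mul_div_mul_left _ _ (inv_ne_zero hs0.ne')]
    rfl
  rw [h6]
  unfold dualWeight
  have : 0 ≤ Real.exp (Δ x) * Q x := by positivity
  gcongr

end Perturbation

/-- By Fatou's lemma the nondegeneracy condition, which is a statement at the spectral parameter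
`Q_*`, persists at some larger parameter. -/
lemma Nondegenerate.exists_le_integral_dualWeight {X Ω : Type*} [MeasurableSpace X]
    [MeasurableSpace Ω] {π : Measure X} {P : Measure Ω} [IsProbabilityMeasure P]
    {r : X → ℝ} {ε : Ω → X → ℝ} {pref : X → ℝ} {α : ℝ}
    [IsProbabilityMeasure (densityMeasure π pref)]
    (hnd : Nondegenerate π P r ε pref α) (hr : Measurable r)
    (hε : Measurable (Function.uncurry ε)) (hα₀ : 0 < α)
    (hQpos : 0 < utilityMax π P r ε) (hQfin : utilityMax π P r ε < ∞) :
    ∃ s : ℝ, 1 < s ∧ (1 - α) / α ≤ ∫ x, dualWeight (s ^ 4 * (utilityMax π P r ε).toReal)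
      (fun x => (utility P r ε x).toReal) x ∂(densityMeasure π pref) := by
  set μ := densityMeasure π pref with hμ
  set M := utilityMax π P r ε with hM
  set U := utility P r ε with hU
  have hUm : Measurable U := measurable_utility hr hε
  have hac : μ ≪ π := withDensity_absolutelyContinuous _ _
  have hle : ∀ᵐ x ∂μ, U x ≤ M := hac.ae_le ae_le_essSup
  have hQ := boundedUtility_utility (P := P) hac hr hε hQfin
  let t : ℕ → ℝ := fun k => 1 + 1 / ((k : ℝ) + 1)
  have ht1 : ∀ k, 1 < t k := fun k => by
    have : (0 : ℝ) < 1 / ((k : ℝ) + 1) := by positivity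
    simp only [t]; linarith
  have htt : Tendsto (fun k => ENNReal.ofReal (t k) * M) atTop (𝓝 M) := by
    have h1 : Tendsto t atTop (𝓝 1) := by
      simpa [t] using tendsto_one_div_add_atTop_nhds_zero_nat.const_add (1 : ℝ)
    have h2 := ENNReal.Tendsto.mul_const (b := M) (ENNReal.tendsto_ofReal h1) (Or.inr hQfin.ne)
    simpa using h2
  let f : ℕ → X → ℝ≥0∞ := fun k x => ENNReal.ofReal (t k) * M / (ENNReal.ofReal (t k) * M - U x)
  have hfm : ∀ k, Measurable (f k) := fun k => measurable_const.div (measurable_const.sub hUm)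
  have hlim : ∀ x, liminf (fun k => f k x) atTop = M / (M - U x) := fun x => by
    refine Tendsto.liminf_eq (ENNReal.Tendsto.div htt (Or.inl hQpos.ne')
      (ENNReal.Tendsto.sub htt tendsto_const_nhds (Or.inl hQfin.ne)) (Or.inr hQfin.ne))
  have hfatou := lintegral_liminf_le (μ := μ) (u := atTop) hfm
  simp only [hlim] at hfatou
  have hlt : (ENNReal.ofReal α)⁻¹ < liminf (fun k => ∫⁻ x, f k x ∂μ) atTop := by
    refine lt_of_lt_of_le ?_ hfatou
    rw [ENNReal.inv_lt_iff_inv_lt]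
    exact hnd
  obtain ⟨k, hk⟩ := (eventually_lt_of_lt_liminf hlt).exists
  have htk := ht1 k
  refine ⟨√√(t k), ?_, ?_⟩
  · rw [Real.lt_sqrt (by norm_num), Real.lt_sqrt (by norm_num)]
    simpa using htk
  have hs4 : √√(t k) ^ 4 = t k := by
    rw [show √√(t k) ^ 4 = (√√(t k) ^ 2) ^ 2 by ring, Real.sq_sqrt (Real.sqrt_nonneg _),
      Real.sq_sqrt (by linarith)]
  rw [hs4]
  have hB : 0 < M.toReal := ENNReal.toReal_pos hQpos.ne' hQfin.ne
  have hl : M.toReal < t k * M.toReal := lt_mul_of_one_lt_left hB htk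
  have hφ := hQ.integrable_dualWeight hl
  have hf : ∀ᵐ x ∂μ, f k x
      = ENNReal.ofReal (1 + dualWeight (t k * M.toReal) (fun x => (U x).toReal) x) := by
    filter_upwards [hle] with x hx
    have hUx : U x ≠ ∞ := (hx.trans_lt hQfin).ne
    have hx' : (U x).toReal ≤ M.toReal := ENNReal.toReal_mono hQfin.ne hx
    have h1 : ENNReal.ofReal (t k) * M = ENNReal.ofReal (t k * M.toReal) := by
      rw [ENNReal.ofReal_mul (by linarith), ENNReal.ofReal_toReal hQfin.ne]
    have h2 : 0 < t k * M.toReal - (U x).toReal := by linarith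
    have h3 : 1 + dualWeight (t k * M.toReal) (fun x => (U x).toReal) x
        = t k * M.toReal / (t k * M.toReal - (U x).toReal) := by
      unfold dualWeight
      field_simp
      ring
    simp only [f]
    rw [h1, h3, ENNReal.ofReal_div_of_pos h2, ENNReal.ofReal_sub _ ENNReal.toReal_nonneg,
      ENNReal.ofReal_toReal hUx]
  have hi : Integrable
      (fun x => 1 + dualWeight (t k * M.toReal) (fun x => (U x).toReal) x) μ :=
    (integrable_const _).add hφ
  rw [lintegral_congr_ae hf, ← ofReal_integral_eq_lintegral_ofReal hi (by
    filter_upwards [hQ.dualWeight_pos hl] with x hx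
    have : 0 < dualWeight (t k * M.toReal) (fun x => (U x).toReal) x := hx
    show (0 : ℝ) ≤ _
    linarith), ← ENNReal.ofReal_inv_of_pos hα₀, integral_add (integrable_const _) hφ] at hk
  have h4 := (ENNReal.ofReal_lt_ofReal_iff_of_nonneg (inv_pos.2 hα₀).le).1 hk
  simp only [integral_const, probReal_univ, smul_eq_mul, mul_one] at h4
  have h5 : (1 - α) / α = α⁻¹ - 1 := by field_simp
  rw [h5]
  linarith

/-! ### Stability of the trajectories -/

lemma IsDensity.isProbabilityMeasure {X : Type*} [MeasurableSpace X] {π : Measure X} {p : X → ℝ}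
    (hp : IsDensity π p) : IsProbabilityMeasure (densityMeasure π p) :=
  ⟨by rw [densityMeasure, withDensity_apply _ MeasurableSet.univ, Measure.restrict_univ, hp.2.2]⟩

/-- The quotient of two densities, one of which dominates the other, is a Radon–Nikodym density. -/
lemma IsDensity.div {X : Type*} [MeasurableSpace X] {π : Measure X} {p q : X → ℝ}
    (hp : IsDensity π p) (hq : IsDensity π q) (hac : densityMeasure π p ≪ densityMeasure π q) :
    IsDensity (densityMeasure π q) (fun x => p x / q x) := by
  have hpm := hp.1
  have hqm := hq.1
  refine ⟨hp.1.div hq.1, fun x => div_nonneg (hp.2.1 x) (hq.2.1 x), ?_⟩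
  have hzero : ∀ᵐ x ∂π, q x = 0 → p x = 0 := by
    have hS : MeasurableSet {x | q x = 0} := hqm (measurableSet_singleton 0)
    have h1 : densityMeasure π q {x | q x = 0} = 0 := by
      rw [densityMeasure, withDensity_apply _ hS, setLIntegral_eq_zero_iff hS (by fun_prop)]
      exact Eventually.of_forall fun x hx => by simp [show q x = 0 from hx]
    have h2 := hac h1
    rw [densityMeasure, withDensity_apply _ hS, setLIntegral_eq_zero_iff hS (by fun_prop)] at h2
    filter_upwards [h2] with x hx h0
    exact le_antisymm (ENNReal.ofReal_eq_zero.1 (hx h0)) (hp.2.1 x)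
  rw [densityMeasure, lintegral_withDensity_eq_lintegral_mul _ (by fun_prop) (by fun_prop),
    ← hp.2.2]
  refine lintegral_congr_ae ?_
  filter_upwards [hzero] with x hx
  simp only [Pi.mul_apply]
  rw [← ENNReal.ofReal_mul (hq.2.1 x)]
  by_cases h : q x = 0
  · simp [h, hx h]
  · rw [mul_div_cancel₀ _ h]

lemma MeasureTheory.Lp.ae_abs_le_norm {X : Type*} [MeasurableSpace X] {π : Measure X}
    (f : Lp ℝ ∞ π) :
    ∀ᵐ x ∂π, |f x| ≤ ‖f‖ := by
  rw [Lp.norm_def, eLpNorm_exponent_top]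
  have hfin : eLpNormEssSup f π ≠ ∞ := by
    rw [← eLpNorm_exponent_top]
    exact (Lp.memLp f).2.ne
  filter_upwards [enorm_ae_le_eLpNormEssSup f π] with x hx
  have := ENNReal.toReal_mono hfin hx
  simpa using this

section Family

variable {X : Type*} [MeasurableSpace X] {π μ : Measure X} [IsProbabilityMeasure μ]
  {Q w : X → ℝ} {B α s : ℝ}

/-- For each finite number of steps the iterates depend continuously on the perturbation. -/
lemma BoundedUtility.tendsto_dTV_iterate (hQ : BoundedUtility μ Q B) (hμ : μ ≪ π)
    (hα₀ : 0 < α) (hα₁ : α < 1) (hw : IsDensity μ w) (n : ℕ) :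
    Tendsto (fun Δ : Lp ℝ ∞ π => dTV μ ((mixMap μ α fun x => Real.exp (Δ x) * Q x)^[n] w)
      ((mixMap μ α fun x => Real.exp ((0 : Lp ℝ ∞ π) x) * Q x)^[n] w)) (𝓝 0) (𝓝 0) := by
  have hsmall : ∀ᶠ Δ : Lp ℝ ∞ π in 𝓝 0, Real.exp ‖Δ‖ ≤ 2 := by
    have h1 : Tendsto (fun Δ : Lp ℝ ∞ π => Real.exp ‖Δ‖) (𝓝 0) (𝓝 1) :=
      (by fun_prop : Continuous fun Δ : Lp ℝ ∞ π => Real.exp ‖Δ‖).tendsto' _ _ (by simp)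
    exact h1.eventually_le_const (by norm_num)
  have hbd (Δ : Lp ℝ ∞ π) (h : Real.exp ‖Δ‖ ≤ 2) :
      BoundedUtility μ (fun x => Real.exp (Δ x) * Q x) (2 * B) :=
    hQ.exp_mul (Lp.stronglyMeasurable Δ).measurable (hμ.ae_le (Lp.ae_abs_le_norm Δ)) h
  have h0 := hbd 0 (by simp)
  -- The chosen representative of `0` in `Lp` vanishes only almost everywhere.
  have hzero : ∀ᵐ x ∂μ, (0 : Lp ℝ ∞ π) x = 0 := hμ.ae_le (Lp.coeFn_zero ℝ ∞ π)
  have key : Tendsto (fun Δ : Lp ℝ ∞ π =>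
      ∫ x, |(mixMap μ α fun x => Real.exp (Δ x) * Q x)^[n] w x
        - (mixMap μ α fun x => Real.exp ((0 : Lp ℝ ∞ π) x) * Q x)^[n] w x| ∂μ)
      (𝓝 0) (𝓝 0) := by
    induction n with
    | zero => simp
    | succ n ih =>
      simp only [Function.iterate_succ_apply']
      set v := (mixMap μ α fun x => Real.exp ((0 : Lp ℝ ∞ π) x) * Q x)^[n] w with hv
      set z := ∫ y, Real.exp ((0 : Lp ℝ ∞ π) y) * Q y * v y ∂μ with hz
      have hbound : Tendsto (fun Δ : Lp ℝ ∞ π => (1 - α) * (2 / z * (2 * B *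
          (∫ x, |(mixMap μ α fun x => Real.exp (Δ x) * Q x)^[n] w x - v x| ∂μ)
            + (Real.exp ‖Δ‖ - 1) * B))) (𝓝 0) (𝓝 0) := by
        have h1 : Tendsto (fun Δ : Lp ℝ ∞ π => (Real.exp ‖Δ‖ - 1) * B) (𝓝 0) (𝓝 0) :=
          (by fun_prop : Continuous fun Δ : Lp ℝ ∞ π => (Real.exp ‖Δ‖ - 1) * B).tendsto' _ _
            (by simp)
        have h2 := (((ih.const_mul (2 * B)).add h1).const_mul (2 / z)).const_mul (1 - α)
        simpa using h2
      refine squeeze_zero' (Eventually.of_forall fun Δ =>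
        integral_nonneg fun _ => abs_nonneg _) ?_ hbound
      filter_upwards [hsmall] with Δ hΔ
      exact h0.integral_abs_mixMap_sub_le (hbd Δ hΔ) hα₁ (h0.isDensity_iterate hα₀ hα₁ hw n)
        ((hbd Δ hΔ).isDensity_iterate hα₀ hα₁ hw n)
        (hQ.abs_exp_mul_sub_le (hμ.ae_le (Lp.ae_abs_le_norm Δ)) hzero)
  have key' := ENNReal.tendsto_ofReal (key.const_mul 2⁻¹)
  rw [mul_zero, ENNReal.ofReal_zero] at key'
  refine key'.congr' ?_
  filter_upwards [hsmall] with Δ hΔ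
  exact (dTV_eq_ofReal ((hbd Δ hΔ).isDensity_iterate hα₀ hα₁ hw n).integrable
    (h0.isDensity_iterate hα₀ hα₁ hw n).integrable).symm

/-- The iterates under every small perturbation converge, at a common geometric rate. -/
lemma BoundedUtility.exists_rate (hQ : BoundedUtility μ Q B) (hμ : μ ≪ π)
    (hα₀ : 0 < α) (hα₁ : α < 1) (hw : IsDensity μ w) (hs : 1 < s)
    (h : (1 - α) / α ≤ ∫ x, dualWeight (s ^ 4 * B) Q x ∂μ) :
    ∃ b : ℕ → ℝ≥0∞, Tendsto b atTop (𝓝 0) ∧ ∀ Δ : Lp ℝ ∞ π, Real.exp ‖Δ‖ ≤ s →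
      (∀ n, IsDensity μ ((mixMap μ α fun x => Real.exp (Δ x) * Q x)^[n] w)) ∧
      ∃ w', IsTVLimit μ (fun n => (mixMap μ α fun x => Real.exp (Δ x) * Q x)^[n] w) w' ∧
        ∀ n, dTV μ ((mixMap μ α fun x => Real.exp (Δ x) * Q x)^[n + 1] w) w' ≤ b n := by
  have hB := hQ.bound_pos
  have hs0 : 0 < s := by linarith
  have hl : s * B < s ^ 3 * B := by
    have : s ^ 3 * B = s ^ 2 * (s * B) := by ring
    rw [this]
    exact lt_mul_of_one_lt_left (by positivity) (one_lt_pow₀ hs (by norm_num))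
  have hb : Tendsto (fun n => ENNReal.ofReal
      (2 * (s * B / (s ^ 3 * B - s * B) / (1 - α)) * (s * B / (s ^ 3 * B)) ^ n)) atTop (𝓝 0) := by
    have h1 := (tendsto_pow_atTop_nhds_zero_of_lt_one
      (by positivity : 0 ≤ s * B / (s ^ 3 * B))
      ((div_lt_one (by positivity)).2 hl)).const_mul
      (2 * (s * B / (s ^ 3 * B - s * B) / (1 - α)))
    simpa using ENNReal.tendsto_ofReal h1
  refine ⟨_, hb, ?_⟩
  intro Δ hΔ
  have hΔm := (Lp.stronglyMeasurable Δ).measurable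
  have hΔn : ∀ᵐ x ∂μ, |Δ x| ≤ ‖Δ‖ := hμ.ae_le (Lp.ae_abs_le_norm Δ)
  have hQ' := hQ.exp_mul hΔm hΔn hΔ
  refine ⟨hQ'.isDensity_iterate hα₀ hα₁ hw, ?_⟩
  obtain ⟨w', hw', hrate⟩ := hQ'.exists_dTV_iterate_le hl hα₀ hα₁
    (h.trans (hQ.integral_dualWeight_le_exp_mul hΔm hΔn hs hΔ))
  refine ⟨w', ⟨hw', ?_⟩, hrate w hw⟩
  exact (tendsto_add_atTop_iff_nat 1).1
    (tendsto_of_tendsto_of_tendsto_of_le_of_le tendsto_const_nhds hb (fun _ => zero_le)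
      (hrate w hw))

end Family

theorem mainTheorem5 {X Ω : Type*} [MeasurableSpace X] [MeasurableSpace Ω]
    (π : Measure X) [SigmaFinite π]
    (P : Measure Ω) [IsProbabilityMeasure P]
    (r : X → ℝ) (hr : Measurable r)
    (ε : Ω → X → ℝ) (hε : Measurable (Function.uncurry ε))
    (α : ℝ) (hα₀ : 0 < α) (hα₁ : α < 1)
    (p₀ pref : X → ℝ) (hp₀ : IsDensity π p₀) (hpref : IsDensity π pref)
    (hac : densityMeasure π p₀ ≪ densityMeasure π pref)
    (hent₀ : FiniteEntropy π p₀) (hentref : FiniteEntropy π pref)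
    (hexp : ExpIntegrable π P r ε)
    (hQpos : 0 < utilityMax π P r ε) (hQfin : utilityMax π P r ε < ∞)
    (hnd : Nondegenerate π P r ε pref α) :
    (∀ᶠ Δr : Lp ℝ ∞ π in 𝓝 0, ∃ w, IsTVLimit (densityMeasure π pref)
      (fun n : ℕ => trajectory π P r ε pref α (fun x => p₀ x / pref x) Δr n) w) ∧
    limsup (fun Δr : Lp ℝ ∞ π => ⨆ n : ℕ∞,
      dTV (densityMeasure π pref)
        (trajectory π P r ε pref α (fun x => p₀ x / pref x) Δr n)
        (trajectory π P r ε pref α (fun x => p₀ x / pref x) 0 n)) (𝓝 0) = 0 := by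
  have := hpref.isProbabilityMeasure
  have hμ : densityMeasure π pref ≪ π := withDensity_absolutelyContinuous _ _
  have hw : IsDensity (densityMeasure π pref) (fun x => p₀ x / pref x) := hp₀.div hpref hac
  have hQ := boundedUtility_utility (P := P) hμ hr hε hQfin
  obtain ⟨s, hs, hφ⟩ := hnd.exists_le_integral_dualWeight hr hε hα₀ hQpos hQfin
  obtain ⟨b, hb, hrate⟩ := hQ.exists_rate hμ hα₀ hα₁ hw hs hφ
  have hmap (Δ : Lp ℝ ∞ π) : perturbedMap π P r ε pref α Δ
      = mixMap (densityMeasure π pref) α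
        fun x => Real.exp (Δ x) * (utility P r ε x).toReal := by
    simp only [perturbedMap, toReal_utility_add]
  simp only [← hmap] at hrate
  have hfin (Δ : Lp ℝ ∞ π) (n : ℕ) : trajectory π P r ε pref α (fun x => p₀ x / pref x) Δ n
      = (perturbedMap π P r ε pref α Δ)^[n] (fun x => p₀ x / pref x) := rfl
  have hsmall : ∀ᶠ Δ : Lp ℝ ∞ π in 𝓝 0, Real.exp ‖Δ‖ ≤ s := by
    have h1 : Tendsto (fun Δ : Lp ℝ ∞ π => Real.exp ‖Δ‖) (𝓝 0) (𝓝 1) :=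
      (by fun_prop : Continuous fun Δ : Lp ℝ ∞ π => Real.exp ‖Δ‖).tendsto' _ _ (by simp)
    exact h1.eventually_le_const hs
  have hlim (Δ : Lp ℝ ∞ π) (hΔ : Real.exp ‖Δ‖ ≤ s) : IsTVLimit (densityMeasure π pref)
      (fun n : ℕ => (perturbedMap π P r ε pref α Δ)^[n] (fun x => p₀ x / pref x))
      (trajectory π P r ε pref α (fun x => p₀ x / pref x) Δ ⊤) := by
    obtain ⟨-, w', hw', -⟩ := hrate Δ hΔ
    exact isTVLimit_limTV ⟨w', hw'⟩
  have hm (Δ : Lp ℝ ∞ π) (hΔ : Real.exp ‖Δ‖ ≤ s) (n : ℕ∞) :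
      Measurable (trajectory π P r ε pref α (fun x => p₀ x / pref x) Δ n) := by
    induction n using ENat.recTopCoe with
    | top => exact (hlim Δ hΔ).1.1
    | coe n => exact ((hrate Δ hΔ).1 n).1
  -- The limit is unique up to null sets, so the chosen limit is approached at the common rate.
  have ht (Δ : Lp ℝ ∞ π) (hΔ : Real.exp ‖Δ‖ ≤ s) (n : ℕ) : dTV (densityMeasure π pref)
      (trajectory π P r ε pref α (fun x => p₀ x / pref x) Δ (n + 1 : ℕ))
      (trajectory π P r ε pref α (fun x => p₀ x / pref x) Δ ⊤) ≤ b n := by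
    obtain ⟨hd, w', hw', hle⟩ := hrate Δ hΔ
    refine (dTV_triangle (hm Δ hΔ _) hw'.1.1).trans ?_
    rw [hw'.dTV_eq_zero (fun n => (hd n).1) (hlim Δ hΔ), add_zero]
    exact hle n
  refine ⟨?_, ?_⟩
  · filter_upwards [hsmall] with Δ hΔ
    exact ⟨_, hlim Δ hΔ⟩
  · have h0 : Real.exp ‖(0 : Lp ℝ ∞ π)‖ ≤ s := by simpa using hs.le
    refine (tendsto_iSup_dTV hb (hsmall.mono hm) (hm 0 h0) (hsmall.mono ht) (ht 0 h0)
      fun n => ?_).limsup_eq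
    simp only [hfin, hmap]
    exact hQ.tendsto_dTV_iterate hμ hα₀ hα₁ hw n
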